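/- **(Sturm–Liouville theorem.)** Let $a<b$ be real, let $q:[a,b]\to\mathbb{R}$ be continuous, and let $(\alpha_0,\alpha_1),(\beta_0,\beta_1)\in\mathbb{R}^2\setminus\{(0,0)\}$. Let $F$ be the space of all $y\in C^2([a,b];\mathbb{C})$ with $$\alpha_0y(a)+\alpha_1y'(a)=0=\beta_0y(b)+\beta_1y'(b),$$ let $D:F\to C([a,b];\mathbb{C})$ be $Dy=-y''+qy$, and for $\lambda\in\mathbb{C}$ let $E_\lambda=\{y\in F: Dy=\lambda y\}$. Call $\lambda\in\mathbb{C}$ an eigenvalue if $E_\lambda\neq\{0\}$. Then: (i) The set of eigenvalues is countably infinite and contained in $\mathbb{R}$; it can be enumerated, without repetitions, as $(\lambda_n)_{n\in\mathbb{N}}$, with $|\lambda_n|\to\infty$ as $n\to\infty$. If $D$ is injective on $F$, then every $\lambda_n$ is nonzero. (ii) For each $n$, the complex vector space $E_{\lambda_n}$ is one-dimensional. (iii) If, for each $n$, $e_n\in E_{\lambda_n}$ has $\|e_n\|_{L^2[a,b]}=1$, then $\{e_n\}_{n\in\mathbb{N}}$ is an orthonormal basis of the complex Hilbert space $L^2[a,b]$.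 -/

import Mathlib

open Set MeasureTheory Filter Topology

noncomputable section

namespace SturmLiouville

/-- The extension of a function on `[a,b]` to `ℝ`, constant on each side of the interval. It is only
used to differentiate within `[a,b]` (one-sidedly at the endpoints), so that the values outside
`[a,b]` play no role. -/
def ext {a b : ℝ} (hab : a < b) (y : C(Icc a b, ℂ)) : ℝ → ℂ :=
  IccExtend hab.le y

theorem ext_add {a b : ℝ} (hab : a < b) (y z : C(Icc a b, ℂ)) :
    ext hab (y + z) = ext hab y + ext hab z := rfl

theorem ext_smul {a b : ℝ} (hab : a < b) (c : ℂ) (y : C(Icc a b, ℂ)) :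
    ext hab (c • y) = c • ext hab y := rfl

theorem ext_zero {a b : ℝ} (hab : a < b) : ext hab (0 : C(Icc a b, ℂ)) = fun _ => 0 := rfl

/-- The space `C²[a,b]` of complex valued functions, as a subspace of `C[a,b]`. -/
def C2 {a b : ℝ} (hab : a < b) : Submodule ℂ C(Icc a b, ℂ) where
  carrier := {y | ContDiffOn ℝ 2 (ext hab y) (Icc a b)}
  add_mem' := by
    intro y z hy hz
    simp only [mem_ofPred_eq] at hy hz ⊢
    rw [ext_add]
    exact hy.add hz
  zero_mem' := by
    simp only [mem_ofPred_eq, ext_zero]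
    exact contDiffOn_const
  smul_mem' := by
    intro c y hy
    simp only [mem_ofPred_eq] at hy ⊢
    rw [ext_smul]
    exact contDiffOn_const.smul hy

/-- The first derivative `y'(x)` at a point `x` of `[a,b]` (one-sided at the endpoints). -/
def d1 {a b : ℝ} (hab : a < b) (y : C(Icc a b, ℂ)) (x : ℝ) : ℂ :=
  derivWithin (ext hab y) (Icc a b) x

/-- The second derivative `y''(x)` at a point `x` of `[a,b]` (one-sided at the endpoints). -/
def d2 {a b : ℝ} (hab : a < b) (y : C(Icc a b, ℂ)) (x : ℝ) : ℂ :=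
  derivWithin (d1 hab y) (Icc a b) x

section facts

theorem diff0 {a b : ℝ} (hab : a < b) {y : C(Icc a b, ℂ)} (hy : y ∈ C2 hab) :
    DifferentiableOn ℝ (ext hab y) (Icc a b) :=
  ContDiffOn.differentiableOn (show ContDiffOn ℝ 2 (ext hab y) (Icc a b) from hy) (by norm_num)

theorem contDiff_d1 {a b : ℝ} (hab : a < b) {y : C(Icc a b, ℂ)} (hy : y ∈ C2 hab) :
    ContDiffOn ℝ 1 (d1 hab y) (Icc a b) :=
  ContDiffOn.derivWithin (show ContDiffOn ℝ 2 (ext hab y) (Icc a b) from hy)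
    (uniqueDiffOn_Icc hab) (by norm_num)

theorem diff1 {a b : ℝ} (hab : a < b) {y : C(Icc a b, ℂ)} (hy : y ∈ C2 hab) :
    DifferentiableOn ℝ (d1 hab y) (Icc a b) :=
  (contDiff_d1 hab hy).differentiableOn (by norm_num)

theorem continuous_d2 {a b : ℝ} (hab : a < b) {y : C(Icc a b, ℂ)} (hy : y ∈ C2 hab) :
    ContinuousOn (d2 hab y) (Icc a b) :=
  (contDiff_d1 hab hy).continuousOn_derivWithin (uniqueDiffOn_Icc hab) (by norm_num)

theorem d1_add {a b : ℝ} (hab : a < b) {y z : C(Icc a b, ℂ)} (hy : y ∈ C2 hab) (hz : z ∈ C2 hab)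
    {x : ℝ} (hx : x ∈ Icc a b) : d1 hab (y + z) x = d1 hab y x + d1 hab z x := by
  unfold d1
  rw [ext_add]
  exact derivWithin_add (diff0 hab hy x hx) (diff0 hab hz x hx)

theorem d1_smul {a b : ℝ} (hab : a < b) (c : ℂ) {y : C(Icc a b, ℂ)} (hy : y ∈ C2 hab)
    {x : ℝ} (hx : x ∈ Icc a b) : d1 hab (c • y) x = c * d1 hab y x := by
  unfold d1
  rw [ext_smul]
  exact derivWithin_const_smul c (diff0 hab hy x hx)

theorem d2_add {a b : ℝ} (hab : a < b) {y z : C(Icc a b, ℂ)} (hy : y ∈ C2 hab) (hz : z ∈ C2 hab)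
    {x : ℝ} (hx : x ∈ Icc a b) : d2 hab (y + z) x = d2 hab y x + d2 hab z x := by
  unfold d2
  rw [derivWithin_congr (f := d1 hab y + d1 hab z) (fun t ht => d1_add hab hy hz ht)
    (d1_add hab hy hz hx)]
  exact derivWithin_add (diff1 hab hy x hx) (diff1 hab hz x hx)

theorem d2_smul {a b : ℝ} (hab : a < b) (c : ℂ) {y : C(Icc a b, ℂ)} (hy : y ∈ C2 hab)
    {x : ℝ} (hx : x ∈ Icc a b) : d2 hab (c • y) x = c * d2 hab y x := by
  unfold d2
  rw [derivWithin_congr (f := c • d1 hab y) (fun t ht => d1_smul hab c hy ht)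
    (d1_smul hab c hy hx)]
  exact derivWithin_const_smul c (diff1 hab hy x hx)

end facts

/-- The space `F` of the `y ∈ C²[a,b]` such that
`α₀ y(a) + α₁ y'(a) = 0 = β₀ y(b) + β₁ y'(b)`. -/
def F {a b : ℝ} (hab : a < b) (α₀ α₁ β₀ β₁ : ℝ) : Submodule ℂ C(Icc a b, ℂ) where
  carrier := {y | y ∈ C2 hab ∧
    (α₀ : ℂ) * y ⟨a, left_mem_Icc.2 hab.le⟩ + (α₁ : ℂ) * d1 hab y a = 0 ∧
    (β₀ : ℂ) * y ⟨b, right_mem_Icc.2 hab.le⟩ + (β₁ : ℂ) * d1 hab y b = 0}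
  add_mem' := by
    rintro y z ⟨hy, hya, hyb⟩ ⟨hz, hza, hzb⟩
    refine ⟨(C2 hab).add_mem hy hz, ?_, ?_⟩
    · rw [d1_add hab hy hz (left_mem_Icc.2 hab.le), ContinuousMap.add_apply]
      linear_combination hya + hza
    · rw [d1_add hab hy hz (right_mem_Icc.2 hab.le), ContinuousMap.add_apply]
      linear_combination hyb + hzb
  zero_mem' := by
    have h : ∀ x, d1 hab (0 : C(Icc a b, ℂ)) x = 0 := by
      intro x
      unfold d1
      rw [ext_zero]
      simp
    refine ⟨(C2 hab).zero_mem, ?_, ?_⟩ <;> simp [h]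
  smul_mem' := by
    rintro c y ⟨hy, hya, hyb⟩
    refine ⟨(C2 hab).smul_mem c hy, ?_, ?_⟩
    · rw [d1_smul hab c hy (left_mem_Icc.2 hab.le), ContinuousMap.smul_apply, smul_eq_mul]
      linear_combination c * hya
    · rw [d1_smul hab c hy (right_mem_Icc.2 hab.le), ContinuousMap.smul_apply, smul_eq_mul]
      linear_combination c * hyb

/-- The operator `D : F → C[a,b]`, `D y = -y'' + q y`. -/
def D {a b : ℝ} (hab : a < b) (q : C(Icc a b, ℝ)) (α₀ α₁ β₀ β₁ : ℝ) :
    F hab α₀ α₁ β₀ β₁ →ₗ[ℂ] C(Icc a b, ℂ) where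
  toFun y :=
    { toFun := fun x => -d2 hab y.1 x + (q x : ℂ) * y.1 x
      continuous_toFun := by
        have h : Continuous fun x : Icc a b => d2 hab y.1 x :=
          continuousOn_iff_continuous_domRestrict.1 (continuous_d2 hab y.2.1)
        fun_prop }
  map_add' := by
    intro y z
    ext x
    simp only [Submodule.coe_add, ContinuousMap.coe_mk, ContinuousMap.add_apply,
      d2_add hab y.2.1 z.2.1 x.2]
    ring
  map_smul' := by
    intro c y
    ext x
    simp only [Submodule.coe_smul, ContinuousMap.coe_mk, ContinuousMap.smul_apply, smul_eq_mul,
      d2_smul hab c y.2.1 x.2, RingHom.id_apply]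
    ring

/-- The space `E_l` of the `y ∈ F` such that `D y = l y`. -/
def E {a b : ℝ} (hab : a < b) (q : C(Icc a b, ℝ)) (α₀ α₁ β₀ β₁ : ℝ) (l : ℂ) :
    Submodule ℂ (F hab α₀ α₁ β₀ β₁) :=
  LinearMap.eqLocus (D hab q α₀ α₁ β₀ β₁) (l • (F hab α₀ α₁ β₀ β₁).subtype)

/-- The set of the eigenvalues: the `l ∈ ℂ` such that `D y = l y` has a solution `y ≠ 0` in `F`. -/
def eigenvalues {a b : ℝ} (hab : a < b) (q : C(Icc a b, ℝ)) (α₀ α₁ β₀ β₁ : ℝ) : Set ℂ :=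
  {l | ∃ y ∈ E hab q α₀ α₁ β₀ β₁ l, y ≠ 0}

/-- Lebesgue measure on `[a,b]`. -/
def leb (a b : ℝ) : Measure (Icc a b) := Measure.comap Subtype.val (volume : Measure ℝ)

instance isFiniteMeasure_leb (a b : ℝ) : IsFiniteMeasure (leb a b) :=
  ⟨by
    rw [leb, comap_subtype_coe_apply measurableSet_Icc, image_univ, Subtype.range_coe]
    exact measure_Icc_lt_top⟩

/-- The space `L²[a,b]` of complex valued functions, with respect to Lebesgue measure. -/
abbrev L2 (a b : ℝ) : Type := Lp ℂ 2 (leb a b)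

/-- The class in `L²[a,b]` of a continuous function on `[a,b]`. -/
def toL2 {a b : ℝ} (y : C(Icc a b, ℂ)) : L2 a b :=
  ContinuousMap.toLp 2 (leb a b) ℂ y

end SturmLiouville

end

/-! The method is to invert a real shift of `D` and apply the spectral theorem for compact symmetric
operators. Integrating Lagrange's identity makes the boundary terms cancel, so `D` is symmetric
(`inner_D_left`). Hence eigenvalues are real and eigenfunctions for distinct eigenvalues are
orthogonal. Since `L²` is separable there are only countably many eigenvalues, so some real `μ` is
not one. Eigenspaces are lines because an eigenfunction is determined by its Cauchy data at `a`,
which the boundary condition confines to a line. For such a `μ`, two solutions of `y'' = (q - μ) y`,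
one for each boundary condition, have nonzero Wronskian and give a Green kernel that inverts `D - μ`
on continuous functions (`exists_resolvent_kernel`). The induced operator on `L²` is compact by
Arzelà–Ascoli, symmetric because `D` is, and injective because its range contains the dense space
`F`. Its eigenvectors for `ν ≠ 0` are exactly the eigenfunctions of `D` for `μ + ν⁻¹`, so these span
a dense subspace. Since `L²` is infinite dimensional there are infinitely many eigenvalues, and `ν →
0` forces `|λ| → ∞`. -/

noncomputable section

namespace SturmLiouville

/-! ### Compact operators and orthonormal families. -/

section FunctionalAnalysis

variable {H : Type*} [NormedAddCommGroup H] [InnerProductSpace ℂ H]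

/-- The operator sending `f` to the continuous function `x ↦ ⟪K x, f⟫`. -/
def innerOp {X : Type*} [TopologicalSpace X] [CompactSpace X] (K : C(X, H)) : H →L[ℂ] C(X, ℂ) :=
  LinearMap.mkContinuous
    { toFun := fun f => ⟨fun x => inner ℂ (K x) f, by fun_prop⟩
      map_add' := fun f g => by ext x; simp
      map_smul' := fun c f => by ext x; simp } ‖K‖ (fun f => by
    refine (ContinuousMap.norm_le _ (by positivity)).2 fun x => ?_
    exact (norm_inner_le_norm _ _).trans (by gcongr; exact K.norm_coe_le_norm x))

@[simp]
theorem innerOp_apply {X : Type*} [TopologicalSpace X] [CompactSpace X] (K : C(X, H)) (f : H)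
    (x : X) : innerOp K f x = inner ℂ (K x) f := rfl

/-- By Cauchy–Schwarz, the image of the unit ball is bounded by `‖K‖` and inherits a common modulus
of continuity from `K`, so Arzelà–Ascoli applies. -/
theorem isCompactOperator_innerOp {X : Type*} [TopologicalSpace X] [CompactSpace X]
    (K : C(X, H)) : IsCompactOperator (innerOp K) := by
  let I := ContinuousMap.linearIsometryBoundedOfCompact X ℂ ℂ
  have hc : IsCompact (closure ((I ∘ innerOp K) '' Metric.closedBall 0 1)) := by
    refine BoundedContinuousFunction.arzela_ascoli (Metric.closedBall (0 : ℂ) ‖K‖)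
      (isCompact_closedBall _ _) _ ?_ ?_
    · rintro _ x ⟨f, hf, rfl⟩
      rw [mem_closedBall_zero_iff] at hf ⊢
      refine (norm_inner_le_norm _ _).trans ?_
      calc ‖K x‖ * ‖f‖ ≤ ‖K‖ * 1 := by gcongr; exact K.norm_coe_le_norm x
        _ = ‖K‖ := mul_one _
    · intro x
      rw [Metric.equicontinuousAt_iff_right]
      intro ε hε
      have := Metric.tendsto_nhds.1 (K.continuous.tendsto x) ε hε
      filter_upwards [this] with z hz
      rintro ⟨_, f, hf, rfl⟩
      rw [mem_closedBall_zero_iff] at hf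
      change dist (inner ℂ (K x) f) (inner ℂ (K z) f) < ε
      rw [dist_eq_norm, ← inner_sub_left]
      refine (norm_inner_le_norm _ _).trans_lt ?_
      calc ‖K x - K z‖ * ‖f‖ ≤ ‖K x - K z‖ * 1 := by gcongr
        _ < ε := by rwa [mul_one, ← dist_eq_norm, dist_comm]
  rw [isCompactOperator_iff_exists_mem_nhds_image_subset_compact]
  refine ⟨Metric.closedBall 0 1, Metric.closedBall_mem_nhds _ one_pos, _,
    hc.image I.symm.continuous, ?_⟩
  rintro _ ⟨f, hf, rfl⟩
  exact ⟨_, subset_closure ⟨f, hf, rfl⟩, by simp⟩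

/-- The eigenvalues of a compact symmetric operator along an orthonormal sequence of
eigenvectors tend to zero. -/
theorem tendsto_eigenvalue_zero {T : H →L[ℂ] H} (hT : IsCompactOperator T)
    (hs : T.IsSymmetric) {e : ℕ → H} (he : Orthonormal ℂ e) {c : ℕ → ℂ}
    (hc : ∀ n, T (e n) = c n • e n) : Tendsto c atTop (𝓝 0) := by
  have hnorm : ∀ n, ‖T (e n)‖ = ‖c n‖ := fun n => by rw [hc, norm_smul, he.1 n, mul_one]
  rw [tendsto_zero_iff_norm_tendsto_zero]
  -- Compactness gives a further subsequence of `T (e n)` with a strong limit `z`. Bessel's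
  -- inequality makes `e n` weakly null, and symmetry transfers this to `T (e n)`, so `z = 0`.
  refine tendsto_of_subseq_tendsto fun ns hns => ?_
  have hK := hT.isCompact_closure_image_closedBall (f := (T : H →ₗ[ℂ] H)) 1
  obtain ⟨z, -, φ, hφ, hz⟩ := hK.tendsto_subseq (x := fun n => T (e (ns n))) (fun n =>
    subset_closure ⟨e (ns n), by simp [he.1], rfl⟩)
  refine ⟨φ, ?_⟩
  have hz0 : z = 0 := by
    have h1 : Tendsto (fun n => inner ℂ z (T (e (ns (φ n))))) atTop (𝓝 (inner ℂ z z)) :=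
      tendsto_const_nhds.inner hz
    have h2 : Tendsto (fun n => inner ℂ (e n) (T z)) atTop (𝓝 0) := by
      have := (he.inner_products_summable (T z)).tendsto_atTop_zero
      rw [tendsto_zero_iff_norm_tendsto_zero]
      simpa using this.sqrt
    have h3 : Tendsto (fun n => inner ℂ z (T (e (ns (φ n))))) atTop (𝓝 0) := by
      have h4 := (h2.comp (hns.comp hφ.tendsto_atTop)).star
      rw [star_zero] at h4
      refine h4.congr fun n => ?_
      have := hs z (e (ns (φ n)))
      simp only [ContinuousLinearMap.coe_coe] at this
      rw [← this]
      exact inner_conj_symm _ _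
    exact inner_self_eq_zero.1 (tendsto_nhds_unique h1 h3)
  have := hz.norm
  rw [hz0, norm_zero] at this
  exact this.congr fun n => hnorm _

/-- An orthonormal family in a separable space is countable. -/
theorem countable_of_orthonormal [TopologicalSpace.SeparableSpace H] {ι : Type*} {e : ι → H}
    (he : Orthonormal ℂ e) : Countable ι := by
  rw [← Set.countable_univ_iff]
  refine Set.PairwiseDisjoint.countable_of_isOpen (s := fun i => Metric.ball (e i) (1 / 2)) ?_
    (fun i _ => Metric.isOpen_ball) (fun i _ => ⟨e i, by simp⟩)
  intro i _ j _ hij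
  refine Metric.ball_disjoint_ball ?_
  -- Distinct members are at distance `√2 > 1`, so balls of radius `1/2` are disjoint.
  have h : ‖e i - e j‖ ^ 2 = 2 := by
    rw [@norm_sub_sq ℂ, he.1 i, he.1 j, he.2 hij]; simp; norm_num
  rw [dist_eq_norm]
  nlinarith [norm_nonneg (e i - e j)]

end FunctionalAnalysis

/-! ### Symmetry of `D` and one-dimensional eigenspaces. -/

section Calculus

variable {a b : ℝ} (hab : a < b)

theorem ext_of_mem (y : C(Icc a b, ℂ)) {x : ℝ} (hx : x ∈ Icc a b) :
    ext hab y x = y ⟨x, hx⟩ := IccExtend_of_mem _ _ hx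

@[simp]
theorem ext_coe (y : C(Icc a b, ℂ)) (x : Icc a b) : ext hab y x = y x := IccExtend_val _ _ _

theorem continuous_ext (y : C(Icc a b, ℂ)) : Continuous (ext hab y) := y.continuous.Icc_extend'

theorem hasDerivWithinAt_ext {y : C(Icc a b, ℂ)} (hy : y ∈ C2 hab) {x : ℝ} (hx : x ∈ Icc a b) :
    HasDerivWithinAt (ext hab y) (d1 hab y x) (Icc a b) x := (diff0 hab hy x hx).hasDerivWithinAt

theorem hasDerivWithinAt_d1 {y : C(Icc a b, ℂ)} (hy : y ∈ C2 hab) {x : ℝ} (hx : x ∈ Icc a b) :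
    HasDerivWithinAt (d1 hab y) (d2 hab y x) (Icc a b) x := (diff1 hab hy x hx).hasDerivWithinAt

/-- A function with given continuous first and second derivatives belongs to `C²[a,b]`. -/
theorem mem_C2_of_hasDerivWithinAt {y : C(Icc a b, ℂ)} {g₀ g₁ g₂ : ℝ → ℂ}
    (h₀ : ∀ x ∈ Icc a b, ext hab y x = g₀ x)
    (h₁ : ∀ x ∈ Icc a b, HasDerivWithinAt g₀ (g₁ x) (Icc a b) x)
    (h₂ : ∀ x ∈ Icc a b, HasDerivWithinAt g₁ (g₂ x) (Icc a b) x)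
    (hc : ContinuousOn g₂ (Icc a b)) :
    y ∈ C2 hab ∧ (∀ x ∈ Icc a b, d1 hab y x = g₁ x) ∧ (∀ x ∈ Icc a b, d2 hab y x = g₂ x) := by
  have hu := uniqueDiffOn_Icc hab
  have hy1 : ∀ x ∈ Icc a b, HasDerivWithinAt (ext hab y) (g₁ x) (Icc a b) x :=
    fun x hx => (h₁ x hx).congr h₀ (h₀ x hx)
  have e1 : ∀ x ∈ Icc a b, d1 hab y x = g₁ x := fun x hx => (hy1 x hx).derivWithin (hu x hx)
  have hy2 : ∀ x ∈ Icc a b, HasDerivWithinAt (d1 hab y) (g₂ x) (Icc a b) x :=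
    fun x hx => (h₂ x hx).congr e1 (e1 x hx)
  have e2 : ∀ x ∈ Icc a b, d2 hab y x = g₂ x := fun x hx => (hy2 x hx).derivWithin (hu x hx)
  refine ⟨?_, e1, e2⟩
  change ContDiffOn ℝ (1 + 1) (ext hab y) (Icc a b)
  rw [contDiffOn_succ_iff_derivWithin hu]
  refine ⟨fun x hx => (hy1 x hx).differentiableWithinAt, by simp, ?_⟩
  change ContDiffOn ℝ (0 + 1) (d1 hab y) (Icc a b)
  rw [contDiffOn_succ_iff_derivWithin hu]
  refine ⟨fun x hx => (hy2 x hx).differentiableWithinAt, by simp, ?_⟩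
  rw [contDiffOn_zero]
  exact hc.congr e2

theorem integral_leb (hab : a < b) (g : ℝ → ℂ) : ∫ x : Icc a b, g x ∂(leb a b) = ∫ x in a..b, g x := by
  rw [intervalIntegral.integral_of_le hab.le, ← integral_Icc_eq_integral_Ioc]
  exact integral_subtype_comap measurableSet_Icc g

theorem inner_toL2 (f g : C(Icc a b, ℂ)) :
    inner ℂ (toL2 f) (toL2 g) =
      ∫ x in a..b, ext hab g x * (starRingEnd ℂ) (ext hab f x) := by
  rw [toL2, toL2, ContinuousMap.inner_toLp, ← integral_leb hab]
  simp

theorem D_apply_ext (q : C(Icc a b, ℝ)) (α₀ α₁ β₀ β₁ : ℝ) (y : F hab α₀ α₁ β₀ β₁) {x : ℝ}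
    (hx : x ∈ Icc a b) : ext hab (D hab q α₀ α₁ β₀ β₁ y) x =
      -d2 hab y.1 x + (IccExtend hab.le q x : ℝ) * ext hab y.1 x := by
  rw [ext_of_mem hab _ hx, ext_of_mem hab _ hx, IccExtend_of_mem _ _ hx]
  rfl

/-- As the coefficients are real, the conjugate of `(p, p')` and the pair `(r, r')` both lie on the
line killed by `(α₀, α₁)`, so their determinant vanishes. -/
theorem boundary_wronskian_eq_zero {α₀ α₁ : ℝ} (hα : (α₀, α₁) ≠ (0, 0)) {p p' r r' : ℂ}
    (hp : α₀ * p + α₁ * p' = 0) (hr : α₀ * r + α₁ * r' = 0) :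
    r' * (starRingEnd ℂ) p - r * (starRingEnd ℂ) p' = 0 := by
  have hp' := congrArg (starRingEnd ℂ) hp
  simp only [map_add, map_mul, Complex.conj_ofReal, map_zero] at hp'
  by_cases h : α₁ = 0
  · have h0 : (α₀ : ℂ) ≠ 0 := by
      rintro h0
      exact hα (by simp [h, Complex.ofReal_eq_zero.1 h0])
    refine mul_left_cancel₀ h0 ?_
    linear_combination r' * hp' - (starRingEnd ℂ p') * hr
  · have h0 : (α₁ : ℂ) ≠ 0 := by exact_mod_cast h
    refine mul_left_cancel₀ h0 ?_
    linear_combination (starRingEnd ℂ p) * hr - r * hp'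

/-- **Lagrange's identity**: the operator `D` is symmetric. -/
theorem inner_D_left (q : C(Icc a b, ℝ)) {α₀ α₁ β₀ β₁ : ℝ} (hα : (α₀, α₁) ≠ (0, 0))
    (hβ : (β₀, β₁) ≠ (0, 0)) (y z : F hab α₀ α₁ β₀ β₁) :
    inner ℂ (toL2 (D hab q α₀ α₁ β₀ β₁ y)) (toL2 z.1) =
      inner ℂ (toL2 y.1) (toL2 (D hab q α₀ α₁ β₀ β₁ z)) := by
  have hy := y.2.1
  have hz := z.2.1
  have hconj : ∀ {f : ℝ → ℂ} {f' : ℂ} {s : Set ℝ} {x : ℝ}, HasDerivWithinAt f f' s x →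
      HasDerivWithinAt (fun t => (starRingEnd ℂ) (f t)) ((starRingEnd ℂ) f') s x :=
    fun h => h.star
  -- The products of first derivatives cancel. What remains is the difference of the two inner
  -- product integrands, since the terms in the real function `q` cancel too.
  have hder : ∀ x ∈ Icc a b, HasDerivWithinAt
      (fun x => d1 hab z.1 x * (starRingEnd ℂ) (ext hab y.1 x) -
        ext hab z.1 x * (starRingEnd ℂ) (d1 hab y.1 x))
      (d2 hab z.1 x * (starRingEnd ℂ) (ext hab y.1 x) -
        ext hab z.1 x * (starRingEnd ℂ) (d2 hab y.1 x)) (Icc a b) x := by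
    intro x hx
    have := ((hasDerivWithinAt_d1 hab hz hx).mul (hconj (hasDerivWithinAt_ext hab hy hx))).sub
      ((hasDerivWithinAt_ext hab hz hx).mul (hconj (hasDerivWithinAt_d1 hab hy hx)))
    refine this.congr_deriv ?_
    ring
  have hcont : ContinuousOn (fun x => d2 hab z.1 x * (starRingEnd ℂ) (ext hab y.1 x) -
        ext hab z.1 x * (starRingEnd ℂ) (d2 hab y.1 x)) (Icc a b) := by
    have c1 := continuous_d2 hab hy
    have c2 := continuous_d2 hab hz
    have c3 := continuous_ext hab y.1
    have c4 := continuous_ext hab z.1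
    have hs : Continuous (starRingEnd ℂ) := Complex.continuous_conj
    exact (c2.mul (hs.comp c3).continuousOn).sub (c4.continuousOn.mul (hs.comp_continuousOn c1))
  have hint := intervalIntegral.integral_eq_sub_of_hasDerivAt_of_le hab.le
    (fun x hx => (hder x hx).continuousWithinAt)
    (fun x hx => (hder x (Ioo_subset_Icc_self hx)).hasDerivAt (Icc_mem_nhds hx.1 hx.2))
    (hcont.intervalIntegrable_of_Icc hab.le)
  rw [boundary_wronskian_eq_zero hα (p := ext hab y.1 a) (r := ext hab z.1 a)
      (by rw [ext_of_mem hab _ (left_mem_Icc.2 hab.le)]; exact y.2.2.1)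
      (by rw [ext_of_mem hab _ (left_mem_Icc.2 hab.le)]; exact z.2.2.1),
    boundary_wronskian_eq_zero hβ (p := ext hab y.1 b) (r := ext hab z.1 b)
      (by rw [ext_of_mem hab _ (right_mem_Icc.2 hab.le)]; exact y.2.2.2)
      (by rw [ext_of_mem hab _ (right_mem_Icc.2 hab.le)]; exact z.2.2.2), sub_zero] at hint
  rw [inner_toL2 hab, inner_toL2 hab, ← sub_eq_zero, ← hint]
  rw [← intervalIntegral.integral_sub]
  · refine intervalIntegral.integral_congr fun x hx => ?_
    rw [uIcc_of_le hab.le] at hx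
    simp only [D_apply_ext hab q α₀ α₁ β₀ β₁ _ hx, map_add, map_neg, map_mul, Complex.conj_ofReal]
    ring
  all_goals
    refine Continuous.intervalIntegrable ?_ _ _
    exact (continuous_ext hab _).mul (Complex.continuous_conj.comp (continuous_ext hab _))

theorem mem_E {q : C(Icc a b, ℝ)} {α₀ α₁ β₀ β₁ : ℝ} {l : ℂ} {y : F hab α₀ α₁ β₀ β₁} :
    y ∈ E hab q α₀ α₁ β₀ β₁ l ↔ D hab q α₀ α₁ β₀ β₁ y = l • y.1 := Iff.rfl

/-- A solution of a homogeneous second order linear equation with zero initial data vanishes. -/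
theorem eq_zero_of_initial_eq_zero {y : C(Icc a b, ℂ)} (hy : y ∈ C2 hab) {M : ℝ}
    (hM : ∀ x ∈ Icc a b, ‖d2 hab y x‖ ≤ M * ‖ext hab y x‖) (h0 : ext hab y a = 0)
    (h1 : d1 hab y a = 0) : y = 0 := by
  have hder : ∀ x ∈ Icc a b, HasDerivWithinAt (fun x => (ext hab y x, d1 hab y x))
      (d1 hab y x, d2 hab y x) (Icc a b) x := fun x hx =>
    (hasDerivWithinAt_ext hab hy hx).prodMk (hasDerivWithinAt_d1 hab hy hx)
  -- Grönwall for the first order system `(y, y')` in the sup norm: the `1` in `max 1 M` bounds the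
  -- first component of the derivative, `M` the second.
  have := eq_zero_of_abs_deriv_le_mul_abs_self_of_eq_zero_right
    (f := fun x => (ext hab y x, d1 hab y x)) (f' := fun x => (d1 hab y x, d2 hab y x))
    (K := max 1 M) (fun x hx => (hder x hx).continuousWithinAt)
    (fun x hx => ((hder x (Ico_subset_Icc_self hx)).mono_of_mem_nhdsWithin
      (Icc_mem_nhdsGE_of_mem hx))) (by simp [h0, h1]) (by
      intro x hx
      rw [Prod.norm_def, Prod.norm_def]
      refine max_le ?_ ?_
      · calc ‖d1 hab y x‖ = 1 * ‖d1 hab y x‖ := (one_mul _).symm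
          _ ≤ _ := by gcongr <;> simp
      · refine (hM x (Ico_subset_Icc_self hx)).trans ?_
        gcongr <;> simp)
  ext x
  have := congrArg Prod.fst (this x x.2)
  simpa using this

theorem d2_of_mem_E {q : C(Icc a b, ℝ)} {α₀ α₁ β₀ β₁ : ℝ} {l : ℂ} {y : F hab α₀ α₁ β₀ β₁}
    (hy : y ∈ E hab q α₀ α₁ β₀ β₁ l) {x : ℝ} (hx : x ∈ Icc a b) :
    d2 hab y.1 x = ((IccExtend hab.le q x : ℝ) - l) * ext hab y.1 x := by
  have := D_apply_ext hab q α₀ α₁ β₀ β₁ y hx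
  rw [(mem_E hab).1 hy, ext_smul] at this
  simp only [Pi.smul_apply, smul_eq_mul] at this
  linear_combination this

/-- The coordinate of an eigenfunction along the line cut out by the boundary condition at `a`. -/
def initialCoord (α₀ α₁ β₀ β₁ : ℝ) : F hab α₀ α₁ β₀ β₁ →ₗ[ℂ] ℂ where
  toFun y := α₁ * ext hab y.1 a - α₀ * d1 hab y.1 a
  map_add' y z := by
    rw [Submodule.coe_add, d1_add hab y.2.1 z.2.1 (left_mem_Icc.2 hab.le), ext_add]
    simp only [Pi.add_apply]
    ring
  map_smul' c y := by
    rw [Submodule.coe_smul, d1_smul hab c y.2.1 (left_mem_Icc.2 hab.le), ext_smul]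
    simp only [Pi.smul_apply, smul_eq_mul, RingHom.id_apply]
    ring

/-- The boundary condition and the vanishing coordinate form a linear system in `y(a)`, `y'(a)` with
determinant `-(α₀² + α₁²) ≠ 0`, so the Cauchy data at `a` vanish. -/
theorem eq_zero_of_initialCoord_eq_zero {q : C(Icc a b, ℝ)} {α₀ α₁ β₀ β₁ : ℝ}
    (hα : (α₀, α₁) ≠ (0, 0)) {l : ℂ} {y : F hab α₀ α₁ β₀ β₁} (hy : y ∈ E hab q α₀ α₁ β₀ β₁ l)
    (h : initialCoord hab α₀ α₁ β₀ β₁ y = 0) : y = 0 := by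
  have h1 : (α₀ : ℂ) * ext hab y.1 a + α₁ * d1 hab y.1 a = 0 := by
    rw [ext_of_mem hab _ (left_mem_Icc.2 hab.le)]; exact y.2.2.1
  have h2 : (α₁ : ℂ) * ext hab y.1 a - α₀ * d1 hab y.1 a = 0 := h
  have hne : (α₀ ^ 2 + α₁ ^ 2 : ℂ) ≠ 0 := by
    norm_cast
    intro h0
    have h3 : α₀ = 0 := by nlinarith
    have h4 : α₁ = 0 := by nlinarith
    exact hα (by simp [h3, h4])
  obtain ⟨M, hM⟩ := isCompact_Icc.exists_bound_of_continuousOn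
    (f := fun x => ((IccExtend hab.le q x : ℝ) - l : ℂ)) (s := Icc a b)
    (by
      have : Continuous (IccExtend hab.le q) := q.continuous.Icc_extend'
      fun_prop)
  refine Subtype.ext (eq_zero_of_initial_eq_zero hab y.2.1 (M := M) (fun x hx => ?_) ?_ ?_)
  · rw [d2_of_mem_E hab hy hx, norm_mul]
    gcongr
    exact hM x hx
  · refine mul_left_cancel₀ hne ?_
    linear_combination α₀ * h1 + α₁ * h2
  · refine mul_left_cancel₀ hne ?_
    linear_combination α₁ * h1 - α₀ * h2

theorem D_sub (q : C(Icc a b, ℝ)) (α₀ α₁ β₀ β₁ : ℝ) (y z : F hab α₀ α₁ β₀ β₁) :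
    D hab q α₀ α₁ β₀ β₁ (y - z) = D hab q α₀ α₁ β₀ β₁ y - D hab q α₀ α₁ β₀ β₁ z :=
  map_sub _ y z

theorem initialCoord_sub (α₀ α₁ β₀ β₁ : ℝ) (y z : F hab α₀ α₁ β₀ β₁) :
    initialCoord hab α₀ α₁ β₀ β₁ (y - z) =
      initialCoord hab α₀ α₁ β₀ β₁ y - initialCoord hab α₀ α₁ β₀ β₁ z :=
  map_sub _ y z

theorem exists_smul_eq_of_mem_E {q : C(Icc a b, ℝ)} {α₀ α₁ β₀ β₁ : ℝ} (hα : (α₀, α₁) ≠ (0, 0))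
    {l : ℂ} {y z : F hab α₀ α₁ β₀ β₁} (hy : y ∈ E hab q α₀ α₁ β₀ β₁ l) (hy0 : y ≠ 0)
    (hz : z ∈ E hab q α₀ α₁ β₀ β₁ l) : ∃ c : ℂ, c • y = z := by
  have hy1 : initialCoord hab α₀ α₁ β₀ β₁ y ≠ 0 :=
    fun h => hy0 (eq_zero_of_initialCoord_eq_zero hab hα hy h)
  refine ⟨initialCoord hab α₀ α₁ β₀ β₁ z / initialCoord hab α₀ α₁ β₀ β₁ y, ?_⟩
  have hmem : (initialCoord hab α₀ α₁ β₀ β₁ z / initialCoord hab α₀ α₁ β₀ β₁ y) • y - z ∈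
      E hab q α₀ α₁ β₀ β₁ l := by
    rw [mem_E]
    rw [D_sub, map_smul, (mem_E hab).1 hy, (mem_E hab).1 hz, Submodule.coe_sub,
      Submodule.coe_smul, smul_sub, smul_comm]
  refine sub_eq_zero.1 (eq_zero_of_initialCoord_eq_zero hab hα hmem ?_)
  rw [initialCoord_sub, map_smul, smul_eq_mul, div_mul_cancel₀ _ hy1, sub_self]

theorem finrank_E_eq_one {q : C(Icc a b, ℝ)} {α₀ α₁ β₀ β₁ : ℝ} (hα : (α₀, α₁) ≠ (0, 0)) {l : ℂ}
    (hl : l ∈ eigenvalues hab q α₀ α₁ β₀ β₁) :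
    Module.finrank ℂ (E hab q α₀ α₁ β₀ β₁ l) = 1 := by
  obtain ⟨y, hy, hy0⟩ := hl
  have hbij : Function.Bijective
      (LinearMap.toSpanSingleton ℂ (E hab q α₀ α₁ β₀ β₁ l) ⟨y, hy⟩) := by
    constructor
    · intro c d hcd
      have h : c • y.1 = d • y.1 := congrArg (fun z => z.1.1) hcd
      exact smul_left_injective ℂ (fun h0 : y.1 = 0 => hy0 (Subtype.ext h0)) h
    · intro z
      obtain ⟨c, hc⟩ := exists_smul_eq_of_mem_E hab hα hy hy0 z.2
      exact ⟨c, Subtype.ext hc⟩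
  rw [← (LinearEquiv.ofBijective _ hbij).finrank_eq, Module.finrank_self]

theorem ae_leb_iff {p : ℝ → Prop} :
    (∀ᵐ x : Icc a b ∂(leb a b), p x) ↔ ∀ᵐ x ∂(volume.restrict (Icc a b)), p x := by
  rw [← map_comap_subtype_coe measurableSet_Icc,
    (MeasurableEmbedding.subtype_coe measurableSet_Icc).ae_map_iff, leb]

theorem toL2_injective (hab : a < b) : Function.Injective (toL2 : C(Icc a b, ℂ) → L2 a b) := by
  intro f g hfg
  have h1 : ∀ᵐ x : Icc a b ∂(leb a b), ext hab f x = ext hab g x := by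
    have hf := ContinuousMap.coeFn_toLp (p := 2) (𝕜 := ℂ) (leb a b) f
    have hg := ContinuousMap.coeFn_toLp (p := 2) (𝕜 := ℂ) (leb a b) g
    rw [toL2, toL2] at hfg
    rw [hfg] at hf
    filter_upwards [hf, hg] with x h1 h2
    rw [ext_coe, ext_coe, ← h1, h2]
  have h2 := Measure.eqOn_Icc_of_ae_eq (μ := volume) hab.ne ((ae_leb_iff
    (p := fun x => ext hab f x = ext hab g x)).1 h1)
    (continuous_ext hab f).continuousOn (continuous_ext hab g).continuousOn
  ext x
  simpa using h2 x.2

end Calculus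

/-! ### Reality, orthogonality and countability of the spectrum. -/

section Eigenvalues

variable {a b : ℝ} (hab : a < b) {q : C(Icc a b, ℝ)} {α₀ α₁ β₀ β₁ : ℝ}

theorem inner_eigen_eq (hα : (α₀, α₁) ≠ (0, 0)) (hβ : (β₀, β₁) ≠ (0, 0)) {l m : ℂ}
    {y z : F hab α₀ α₁ β₀ β₁} (hy : y ∈ E hab q α₀ α₁ β₀ β₁ l) (hz : z ∈ E hab q α₀ α₁ β₀ β₁ m) :
    (starRingEnd ℂ) l * inner ℂ (toL2 y.1) (toL2 z.1) = m * inner ℂ (toL2 y.1) (toL2 z.1) := by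
  have h := inner_D_left hab q hα hβ y z
  rw [(mem_E hab).1 hy, (mem_E hab).1 hz, toL2, toL2, toL2, toL2, map_smul, map_smul,
    inner_smul_left, inner_smul_right] at h
  exact h

theorem toL2_ne_zero {y : F hab α₀ α₁ β₀ β₁} (hy : y ≠ 0) : toL2 y.1 ≠ 0 := by
  intro h
  refine hy (Subtype.ext (toL2_injective hab (h.trans ?_)))
  exact (map_zero (ContinuousMap.toLp 2 (leb a b) ℂ)).symm

theorem conj_eigenvalue (hα : (α₀, α₁) ≠ (0, 0)) (hβ : (β₀, β₁) ≠ (0, 0)) {l : ℂ}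
    (hl : l ∈ eigenvalues hab q α₀ α₁ β₀ β₁) : (starRingEnd ℂ) l = l := by
  obtain ⟨y, hy, hy0⟩ := hl
  exact mul_right_cancel₀ (inner_self_ne_zero.2 (toL2_ne_zero hab hy0))
    (inner_eigen_eq hab hα hβ hy hy)

theorem exists_normalized_eigenfunction {l : ℂ} (hl : l ∈ eigenvalues hab q α₀ α₁ β₀ β₁) :
    ∃ y ∈ E hab q α₀ α₁ β₀ β₁ l, ‖toL2 y.1‖ = 1 := by
  obtain ⟨y, hy, hy0⟩ := hl
  have hn : ‖toL2 y.1‖ ≠ 0 := norm_ne_zero_iff.2 (toL2_ne_zero hab hy0)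
  refine ⟨((‖toL2 y.1‖⁻¹ : ℝ) : ℂ) • y, Submodule.smul_mem _ _ hy, ?_⟩
  have : toL2 (((‖toL2 y.1‖⁻¹ : ℝ) : ℂ) • y).1 = ((‖toL2 y.1‖⁻¹ : ℝ) : ℂ) • toL2 y.1 :=
    map_smul (ContinuousMap.toLp 2 (leb a b) ℂ) _ _
  rw [this, norm_smul, Complex.norm_real, norm_inv, norm_norm, inv_mul_cancel₀ hn]

theorem orthonormal_of_mem_E (hα : (α₀, α₁) ≠ (0, 0)) (hβ : (β₀, β₁) ≠ (0, 0)) {ι : Type*}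
    {l : ι → ℂ} (hl : Function.Injective l) {e : ι → F hab α₀ α₁ β₀ β₁}
    (he : ∀ i, e i ∈ E hab q α₀ α₁ β₀ β₁ (l i)) (hn : ∀ i, ‖toL2 (e i).1‖ = 1) :
    Orthonormal ℂ (fun i => toL2 (e i).1) := by
  refine ⟨hn, fun i j hij => ?_⟩
  have hi : (starRingEnd ℂ) (l i) = l i := by
    refine conj_eigenvalue hab hα hβ ⟨e i, he i, fun h0 => ?_⟩
    have h := hn i
    have h1 : toL2 (e i).1 = 0 := by
      rw [h0]
      exact map_zero (ContinuousMap.toLp 2 (leb a b) ℂ)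
    rw [h1, norm_zero] at h
    exact zero_ne_one h
  have h := inner_eigen_eq hab hα hβ (he i) (he j)
  rw [hi, ← sub_eq_zero, ← sub_mul] at h
  exact (mul_eq_zero.1 h).resolve_left (sub_ne_zero.2 fun h => hij (hl h))

theorem countable_eigenvalues (hα : (α₀, α₁) ≠ (0, 0)) (hβ : (β₀, β₁) ≠ (0, 0)) :
    (eigenvalues hab q α₀ α₁ β₀ β₁).Countable := by
  choose e he hn using fun l : eigenvalues hab q α₀ α₁ β₀ β₁ =>
    exists_normalized_eigenfunction hab l.2
  have : Fact ((2 : ENNReal) ≠ ⊤) := ⟨by simp⟩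
  exact countable_of_orthonormal
    (orthonormal_of_mem_E hab hα hβ Subtype.val_injective he hn)

/-- This supplies the shift that makes `D - μ` invertible, with no lower bound on the spectrum
needed. -/
theorem exists_real_notMem_eigenvalues (q : C(Icc a b, ℝ)) (hα : (α₀, α₁) ≠ (0, 0))
    (hβ : (β₀, β₁) ≠ (0, 0)) : ∃ μ : ℝ, (μ : ℂ) ∉ eigenvalues hab q α₀ α₁ β₀ β₁ := by
  by_contra! h
  refine Cardinal.not_countable_real ?_
  have := (countable_eigenvalues hab (q := q) hα hβ).preimage Complex.ofReal_injective
  exact this.mono fun μ _ => h μ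

end Eigenvalues

/-! ### The linear initial value problem on the whole interval. -/

section Existence

/-- Existence of solutions of `u'' = Q u` on a compact interval with prescribed initial data. -/
theorem exists_solution_of_initial {a b : ℝ} (hab : a ≤ b) {Q : ℝ → ℝ}
    (hQ : ContinuousOn Q (Icc a b)) (p p' : ℝ) :
    ∃ u u' : ℝ → ℝ, Continuous u ∧ u a = p ∧ u' a = p' ∧
      (∀ t ∈ Icc a b, HasDerivWithinAt u (u' t) (Icc a b) t) ∧
      ∀ t ∈ Icc a b, HasDerivWithinAt u' (Q t * u t) (Icc a b) t := by
  obtain ⟨M, hM⟩ := isCompact_Icc.exists_bound_of_continuousOn hQ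
  obtain ⟨K, hK1, hKM⟩ : ∃ K : NNReal, 1 ≤ (K : ℝ) ∧ ∀ t ∈ Icc a b, |Q t| ≤ K := by
    refine ⟨⟨max 1 M, by positivity⟩, le_max_left _ _, fun t ht => ?_⟩
    exact (hM t ht).trans (le_max_right _ _)
  -- `R` is the Grönwall a priori bound. Truncating the field at `±R` bounds it by `K * R`, so
  -- Picard–Lindelöf reaches all of `[a,b]`. The bound also holds for the truncated system, whose
  -- solution thus never meets the truncation.
  obtain ⟨R, hR⟩ : ∃ R : NNReal, (R : ℝ) = ‖(p, p')‖ * Real.exp (K * (b - a)) :=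
    ⟨⟨_, by positivity⟩, rfl⟩
  let cl : ℝ → ℝ := fun x => max (-R) (min R x)
  have hcl_lip : ∀ x y, |cl x - cl y| ≤ |x - y| := by
    have : LipschitzWith 1 cl := (LipschitzWith.id.const_min (R : ℝ)).const_max (-R : ℝ)
    intro x y
    simpa [Real.dist_eq] using this.dist_le_mul x y
  have hR0 : (0 : ℝ) ≤ R := R.2
  have hcl_le : ∀ x, |cl x| ≤ R := fun x =>
    abs_le.2 ⟨le_max_left _ _, max_le (by linarith) (min_le_left _ _)⟩
  have hcl0 : cl 0 = 0 := by simp [cl]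
  have hcl_abs : ∀ x, |cl x| ≤ |x| := fun x => by simpa [hcl0] using hcl_lip x 0
  have hcl_eq : ∀ x : ℝ, |x| ≤ R → cl x = x := fun x hx => by
    rw [abs_le] at hx
    simp only [cl]
    rw [min_eq_right hx.2, max_eq_right hx.1]
  let f : ℝ → ℝ × ℝ → ℝ × ℝ := fun t x => (cl x.2, Q t * cl x.1)
  have hK0 : (0 : ℝ) ≤ K := K.2
  have hf : IsPicardLindelof f (⟨a, left_mem_Icc.2 hab⟩ : Icc a b) (p, p')
      (K * R * ⟨b - a, sub_nonneg.2 hab⟩) 0 (K * R) K := by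
    refine ⟨fun t ht => ?_, fun x _ => ?_, fun t ht x _ => ?_, ?_⟩
    · refine (LipschitzWith.of_dist_le_mul fun x y => ?_).lipschitzOnWith
      rw [Prod.dist_eq, Prod.dist_eq]
      simp only [Real.dist_eq, f]
      refine max_le ?_ ?_
      · calc |cl x.2 - cl y.2| ≤ 1 * |x.2 - y.2| := by rw [one_mul]; exact hcl_lip _ _
          _ ≤ K * max |x.1 - y.1| |x.2 - y.2| := by gcongr; exact le_max_right _ _
      · rw [← mul_sub, abs_mul]
        calc |Q t| * |cl x.1 - cl y.1| ≤ K * |x.1 - y.1| := by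
              exact mul_le_mul (hKM t ht) (hcl_lip _ _) (abs_nonneg _) hK0
          _ ≤ K * max |x.1 - y.1| |x.2 - y.2| := by gcongr; exact le_max_left _ _
    · exact continuousOn_const.prodMk (hQ.mul continuousOn_const)
    · rw [Prod.norm_def]
      simp only [Real.norm_eq_abs, f, NNReal.coe_mul]
      refine max_le ?_ ?_
      · exact (hcl_le _).trans (le_mul_of_one_le_left hR0 hK1)
      · rw [abs_mul]
        gcongr
        · exact hKM t ht
        · exact hcl_le _
    · have : max (b - a) (a - a) = b - a := by simp [hab]
      rw [this, NNReal.coe_zero, sub_zero]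
      rfl
  obtain ⟨γ, hγ0, hγ⟩ := hf.exists_eq_forall_mem_Icc_hasDerivWithinAt₀
  have hbound : ∀ t ∈ Icc a b, ‖γ t‖ ≤ R := by
    intro t ht
    have h := norm_le_gronwallBound_of_norm_deriv_right_le (δ := ‖(p, p')‖) (K := K) (ε := 0)
      (fun x hx => (hγ x hx).continuousWithinAt)
      (fun x hx => ((hγ x (Ico_subset_Icc_self hx)).mono_of_mem_nhdsWithin
        (Icc_mem_nhdsGE_of_mem hx))) (by rw [← hγ0]) (fun x hx => ?_) t ht
    · refine h.trans ?_
      rw [gronwallBound_ε0, hR]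
      gcongr
      exact ht.2
    · rw [Prod.norm_def, Prod.norm_def, add_zero]
      simp only [Real.norm_eq_abs, f]
      refine max_le ?_ ?_
      · calc |cl (γ x).2| ≤ 1 * |(γ x).2| := by rw [one_mul]; exact hcl_abs _
          _ ≤ _ := by gcongr; exact le_max_right _ _
      · rw [abs_mul]
        gcongr
        · exact hKM x (Ico_subset_Icc_self hx)
        · exact (hcl_abs _).trans (le_max_left _ _)
  have hu' : ∀ t ∈ Icc a b, HasDerivWithinAt (fun t => (γ t).1) (γ t).2 (Icc a b) t := by
    intro t ht
    have h : HasDerivWithinAt (fun t => (γ t).1) (f t (γ t)).1 (Icc a b) t :=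
      (ContinuousLinearMap.fst ℝ ℝ ℝ).hasFDerivAt.comp_hasDerivWithinAt t (hγ t ht)
    rwa [show (f t (γ t)).1 = (γ t).2 from hcl_eq _ ((norm_snd_le _).trans (hbound t ht))] at h
  have hcont : ContinuousOn (fun t => (γ t).1) (Icc a b) :=
    fun t ht => (hu' t ht).continuousWithinAt
  have hext : ∀ t ∈ Icc a b, IccExtend hab ((Icc a b).domRestrict fun t => (γ t).1) t = (γ t).1 :=
    fun t ht => IccExtend_of_mem _ _ ht
  refine ⟨IccExtend hab ((Icc a b).domRestrict fun t => (γ t).1), fun t => (γ t).2,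
    hcont.domRestrict.Icc_extend', ?_, by simp [hγ0],
    fun t ht => (hu' t ht).congr hext (hext t ht), fun t ht => ?_⟩
  · rw [hext a (left_mem_Icc.2 hab), hγ0]
  · have h : HasDerivWithinAt (fun t => (γ t).2) (f t (γ t)).2 (Icc a b) t :=
      (ContinuousLinearMap.snd ℝ ℝ ℝ).hasFDerivAt.comp_hasDerivWithinAt t (hγ t ht)
    rwa [show (f t (γ t)).2 = Q t * (γ t).1 from
      congrArg (Q t * ·) (hcl_eq _ ((norm_fst_le _).trans (hbound t ht))), ← hext t ht] at h

end Existence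

/-! ### The Green kernel. -/

section Green

variable {a b : ℝ} (hab : a < b) {q : C(Icc a b, ℝ)} {α₀ α₁ β₀ β₁ : ℝ}

theorem d1_zero (x : ℝ) : d1 hab 0 x = 0 := by
  rw [d1, ext_zero]
  simp

/-- Away from the real eigenvalues there is a pair of solutions with nonzero Wronskian, each
satisfying one of the boundary conditions. -/
theorem exists_fundamental_pair (q : C(Icc a b, ℝ)) (hα : (α₀, α₁) ≠ (0, 0)) {μ : ℝ}
    (hμ : (μ : ℂ) ∉ eigenvalues hab q α₀ α₁ β₀ β₁) :
    ∃ (u u' v v' : ℝ → ℝ) (W : ℝ), W ≠ 0 ∧ Continuous u ∧ Continuous v ∧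
      (∀ t ∈ Icc a b, HasDerivWithinAt u (u' t) (Icc a b) t) ∧
      (∀ t ∈ Icc a b, HasDerivWithinAt u' ((IccExtend hab.le q t - μ) * u t) (Icc a b) t) ∧
      (∀ t ∈ Icc a b, HasDerivWithinAt v (v' t) (Icc a b) t) ∧
      (∀ t ∈ Icc a b, HasDerivWithinAt v' ((IccExtend hab.le q t - μ) * v t) (Icc a b) t) ∧
      α₀ * u a + α₁ * u' a = 0 ∧ β₀ * v b + β₁ * v' b = 0 ∧
      ∀ t ∈ Icc a b, u' t * v t - u t * v' t = W := by
  have hq : Continuous (IccExtend hab.le q) := q.continuous.Icc_extend'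
  have hQ : ContinuousOn (fun t => IccExtend hab.le q t - μ) (Icc a b) := by fun_prop
  have ha := left_mem_Icc.2 hab.le
  have hb := right_mem_Icc.2 hab.le
  -- The data of `u` satisfy the condition at `a`; those of `w` are orthogonal to them, so `u' w - u
  -- w'` equals `-(α₀² + α₁²)` at `a`.
  obtain ⟨u, u', hu, hua, hu'a, hu1, hu2⟩ := exists_solution_of_initial hab.le hQ α₁ (-α₀)
  obtain ⟨w, w', hw, hwa, hw'a, hw1, hw2⟩ := exists_solution_of_initial hab.le hQ α₀ α₁
  -- Otherwise `u` would satisfy both boundary conditions and be an eigenfunction for `μ`.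
  have hB : β₀ * u b + β₁ * u' b ≠ 0 := by
    intro hB
    apply hμ
    let y : C(Icc a b, ℂ) := ⟨fun x => (u x : ℂ), by fun_prop⟩
    have hy : ∀ x ∈ Icc a b, ext hab y x = (u x : ℂ) := fun x hx => ext_of_mem hab y hx
    obtain ⟨hC, h1, h2⟩ := mem_C2_of_hasDerivWithinAt hab hy
      (fun x hx => (hu1 x hx).ofReal_comp) (fun x hx => (hu2 x hx).ofReal_comp)
      (by fun_prop)
    have hF : y ∈ F hab α₀ α₁ β₀ β₁ := by
      refine ⟨hC, ?_, ?_⟩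
      · rw [h1 a ha]
        change (α₀ : ℂ) * (u a : ℂ) + _ = 0
        rw [hua, hu'a]
        push_cast
        ring
      · rw [h1 b hb]
        change (β₀ : ℂ) * (u b : ℂ) + _ = 0
        exact_mod_cast hB
    refine ⟨⟨y, hF⟩, (mem_E hab).2 ?_, fun h0 => ?_⟩
    · ext x
      have hD := D_apply_ext hab q α₀ α₁ β₀ β₁ ⟨y, hF⟩ x.2
      rw [ext_coe, h2 x x.2, hy x x.2] at hD
      rw [hD, ContinuousMap.smul_apply, smul_eq_mul]
      change _ = _ * (u x : ℂ)
      push_cast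
      ring
    · have hy0 : y = 0 := congrArg Subtype.val h0
      have e1 := hy a ha
      have e2 := h1 a ha
      rw [hy0, ext_zero, hua] at e1
      rw [hy0, d1_zero, hu'a] at e2
      have e3 : α₁ = 0 := Complex.ofReal_eq_zero.1 e1.symm
      have e4 : α₀ = 0 := neg_eq_zero.1 (Complex.ofReal_eq_zero.1 e2.symm)
      exact hα (by rw [e3, e4])
  have hne : α₀ ^ 2 + α₁ ^ 2 ≠ 0 := by
    intro h0
    have h3 : α₀ = 0 := by nlinarith
    have h4 : α₁ = 0 := by nlinarith
    exact hα (by simp [h3, h4])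
  -- This `c` makes `w - c u` satisfy the condition at `b`; subtracting a multiple of `u` leaves the
  -- Wronskian unchanged.
  let c := (β₀ * w b + β₁ * w' b) / (β₀ * u b + β₁ * u' b)
  have hv1 : ∀ t ∈ Icc a b, HasDerivWithinAt (fun t => w t - c * u t) (w' t - c * u' t)
      (Icc a b) t := fun t ht => (hw1 t ht).sub ((hu1 t ht).const_mul c)
  have hv2 : ∀ t ∈ Icc a b, HasDerivWithinAt (fun t => w' t - c * u' t)
      ((IccExtend hab.le q t - μ) * (w t - c * u t)) (Icc a b) t := fun t ht =>
    ((hw2 t ht).sub ((hu2 t ht).const_mul c)).congr_deriv (by ring)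
  have hWd : ∀ t ∈ Icc a b, HasDerivWithinAt
      (fun t => u' t * (w t - c * u t) - u t * (w' t - c * u' t)) 0 (Icc a b) t := fun t ht =>
    (((hu2 t ht).mul (hv1 t ht)).sub ((hu1 t ht).mul (hv2 t ht))).congr_deriv (by ring)
  refine ⟨u, u', fun t => w t - c * u t, fun t => w' t - c * u' t, -(α₀ ^ 2 + α₁ ^ 2),
    neg_ne_zero.2 hne, hu, by fun_prop, hu1, hu2, hv1, hv2, ?_, ?_, ?_⟩
  · rw [hua, hu'a]; ring
  · have : c * (β₀ * u b + β₁ * u' b) = β₀ * w b + β₁ * w' b := div_mul_cancel₀ _ hB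
    linear_combination -this
  · intro t ht
    have := constant_of_has_deriv_right_zero (fun x hx => (hWd x hx).continuousWithinAt)
      (fun x hx => ((hWd x (Ico_subset_Icc_self hx)).mono_of_mem_nhdsWithin
        (Icc_mem_nhdsGE_of_mem hx))) t ht
    rw [this, hua, hu'a, hwa, hw'a]
    ring

/-- The kernel `u (min x s) * v (max x s) / W` as a continuous map into `L²[a,b]`. -/
def greenKernel {u v : ℝ → ℝ} (hu : Continuous u) (hv : Continuous v) (W : ℝ) :
    C(Icc a b, L2 a b) :=
  (⟨toL2, (ContinuousMap.toLp 2 (leb a b) ℂ).continuous⟩ : C(C(Icc a b, ℂ), L2 a b)).comp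
    (ContinuousMap.curry ⟨fun p : Icc a b × Icc a b =>
      ((u (min p.1.1 p.2.1) * v (max p.1.1 p.2.1) / W : ℝ) : ℂ), by fun_prop⟩)

theorem innerOp_greenKernel {u v : ℝ → ℝ} (hu : Continuous u) (hv : Continuous v) (W : ℝ)
    (f : C(Icc a b, ℂ)) {x : ℝ} (hx : x ∈ Icc a b) :
    ext hab (innerOp (greenKernel hu hv W) (toL2 f)) x =
      ((v x : ℂ) * (∫ s in a..x, (u s : ℂ) * ext hab f s) +
        (u x : ℂ) * ∫ s in x..b, (v s : ℂ) * ext hab f s) / W := by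
  have hf := continuous_ext hab f
  let k : C(Icc a b, ℂ) := ⟨fun s => ((u (min x s.1) * v (max x s.1) / W : ℝ) : ℂ), by fun_prop⟩
  have hk : greenKernel hu hv W ⟨x, hx⟩ = toL2 k := rfl
  have hks : ∀ s ∈ Icc a b, ext hab k s = ((u (min x s) * v (max x s) / W : ℝ) : ℂ) :=
    fun s hs => ext_of_mem hab k hs
  have hi : ∀ c d, IntervalIntegrable (fun s => ext hab f s * (starRingEnd ℂ) (ext hab k s))
      volume c d := fun c d =>
    (hf.mul (Complex.continuous_conj.comp (continuous_ext hab k))).intervalIntegrable _ _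
  rw [ext_of_mem hab _ hx, innerOp_apply, hk, inner_toL2 hab,
    ← intervalIntegral.integral_add_adjacent_intervals (hi a x) (hi x b), add_div]
  congr 1
  · rw [← intervalIntegral.integral_const_mul, ← intervalIntegral.integral_div]
    refine intervalIntegral.integral_congr fun s hs => ?_
    rw [uIcc_of_le hx.1] at hs
    rw [hks s ⟨hs.1, hs.2.trans hx.2⟩, Complex.conj_ofReal, min_eq_right hs.2, max_eq_left hs.2]
    push_cast
    ring
  · rw [← intervalIntegral.integral_const_mul, ← intervalIntegral.integral_div]
    refine intervalIntegral.integral_congr fun s hs => ?_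
    rw [uIcc_of_le hx.2] at hs
    rw [hks s ⟨hx.1.trans hs.1, hs.2⟩, Complex.conj_ofReal, min_eq_left hs.1, max_eq_right hs.1]
    push_cast
    ring

/-- The resolvent of `D` at a real number which is not an eigenvalue is an integral operator. -/
theorem exists_resolvent_kernel (q : C(Icc a b, ℝ)) (hα : (α₀, α₁) ≠ (0, 0)) {μ : ℝ}
    (hμ : (μ : ℂ) ∉ eigenvalues hab q α₀ α₁ β₀ β₁) :
    ∃ K : C(Icc a b, L2 a b), ∀ f : C(Icc a b, ℂ), ∃ y : F hab α₀ α₁ β₀ β₁,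
      y.1 = innerOp K (toL2 f) ∧ D hab q α₀ α₁ β₀ β₁ y = (μ : ℂ) • y.1 + f := by
  obtain ⟨u, u', v, v', W, hW, hu, hv, hu1, hu2, hv1, hv2, hua, hvb, hWr⟩ :=
    exists_fundamental_pair hab q hα hμ
  refine ⟨greenKernel hu hv W, fun f => ?_⟩
  have ha := left_mem_Icc.2 hab.le
  have hb := right_mem_Icc.2 hab.le
  have hf := continuous_ext hab f
  have hW' : (W : ℂ) ≠ 0 := by exact_mod_cast hW
  have hq : Continuous (IccExtend hab.le q) := q.continuous.Icc_extend'
  set P : ℝ → ℂ := fun x => ∫ s in a..x, (u s : ℂ) * ext hab f s with hP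
  set R : ℝ → ℂ := fun x => ∫ s in x..b, (v s : ℂ) * ext hab f s with hR
  have hPd : ∀ x, HasDerivAt P ((u x : ℂ) * ext hab f x) x := fun x =>
    Continuous.integral_hasStrictDerivAt (by fun_prop) a x |>.hasDerivAt
  have hRd : ∀ x, HasDerivAt R (-((v x : ℂ) * ext hab f x)) x := by
    intro x
    have hc : Continuous fun s => (v s : ℂ) * ext hab f s := by fun_prop
    exact intervalIntegral.integral_hasDerivAt_left (hc.intervalIntegrable _ _)
      (hc.stronglyMeasurableAtFilter _ _) hc.continuousAt
  have hPc : Continuous P := continuous_iff_continuousAt.2 fun x => (hPd x).continuousAt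
  have hRc : Continuous R := continuous_iff_continuousAt.2 fun x => (hRd x).continuousAt
  -- Variation of parameters: the terms from the moving limits cancel in the first derivative, and
  -- in the second they add up to `-f` by the Wronskian identity.
  obtain ⟨hC, h1, h2⟩ := mem_C2_of_hasDerivWithinAt hab
    (y := innerOp (greenKernel hu hv W) (toL2 f))
    (g₀ := fun x => (v x * P x + u x * R x) / W)
    (g₁ := fun x => (v' x * P x + u' x * R x) / W)
    (g₂ := fun x => ((IccExtend hab.le q x - μ : ℝ) : ℂ) * ((v x * P x + u x * R x) / W) -
      ext hab f x)
    (fun x hx => innerOp_greenKernel hab hu hv W f hx)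
    (fun x hx => by
      refine ((((hv1 x hx).ofReal_comp.mul (hPd x).hasDerivWithinAt).add
        ((hu1 x hx).ofReal_comp.mul (hRd x).hasDerivWithinAt)).div_const _).congr_deriv ?_
      field_simp
      ring)
    (fun x hx => by
      refine ((((hv2 x hx).ofReal_comp.mul (hPd x).hasDerivWithinAt).add
        ((hu2 x hx).ofReal_comp.mul (hRd x).hasDerivWithinAt)).div_const _).congr_deriv ?_
      have hw : (u' x * v x - u x * v' x : ℂ) = W := by exact_mod_cast hWr x hx
      field_simp
      push_cast
      linear_combination (-ext hab f x) * hw)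
    (by fun_prop)
  have hy0 : ∀ x (hx : x ∈ Icc a b), innerOp (greenKernel hu hv W) (toL2 f) ⟨x, hx⟩ =
      (v x * P x + u x * R x) / W := fun x hx => by
    rw [← ext_of_mem hab _ hx]
    exact innerOp_greenKernel hab hu hv W f hx
  have hF : innerOp (greenKernel hu hv W) (toL2 f) ∈ F hab α₀ α₁ β₀ β₁ := by
    refine ⟨hC, ?_, ?_⟩
    · have hPa : P a = 0 := intervalIntegral.integral_same
      have hua' : (α₀ * u a + α₁ * u' a : ℂ) = 0 := by exact_mod_cast hua
      rw [h1 a ha, hy0 a ha, hPa]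
      linear_combination R a / W * hua'
    · have hRb : R b = 0 := intervalIntegral.integral_same
      have hvb' : (β₀ * v b + β₁ * v' b : ℂ) = 0 := by exact_mod_cast hvb
      rw [h1 b hb, hy0 b hb, hRb]
      linear_combination P b / W * hvb'
  refine ⟨⟨_, hF⟩, rfl, ?_⟩
  ext x
  have hD := D_apply_ext hab q α₀ α₁ β₀ β₁ ⟨_, hF⟩ x.2
  rw [ext_coe, h2 x x.2, ext_coe, ext_coe, hy0 x x.2] at hD
  rw [hD, ContinuousMap.add_apply, ContinuousMap.smul_apply, smul_eq_mul, hy0 x x.2]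
  push_cast
  ring

end Green

/-! ### The resolvent on `L²`, completeness and growth of the eigenvalues. -/

section Resolvent

variable {a b : ℝ} (hab : a < b) {q : C(Icc a b, ℝ)} {α₀ α₁ β₀ β₁ : ℝ}

theorem toL2_add (y z : C(Icc a b, ℂ)) : toL2 (y + z) = toL2 y + toL2 z :=
  map_add (ContinuousMap.toLp 2 (leb a b) ℂ) y z

theorem toL2_smul (c : ℂ) (y : C(Icc a b, ℂ)) : toL2 (c • y) = c • toL2 y :=
  map_smul (ContinuousMap.toLp 2 (leb a b) ℂ) c y

theorem toL2_zero : toL2 (0 : C(Icc a b, ℂ)) = 0 :=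
  map_zero (ContinuousMap.toLp 2 (leb a b) ℂ)

theorem toL2_denseRange : DenseRange (toL2 : C(Icc a b, ℂ) → L2 a b) :=
  ContinuousMap.toLp_denseRange ℂ (leb a b) ℂ (by simp)

/-- The operator on `L²[a,b]` with kernel `K`. -/
def resolvent (K : C(Icc a b, L2 a b)) : L2 a b →L[ℂ] L2 a b :=
  (ContinuousMap.toLp 2 (leb a b) ℂ).comp (innerOp K)

theorem resolvent_apply (K : C(Icc a b, L2 a b)) (f : L2 a b) :
    resolvent K f = toL2 (innerOp K f) := rfl

theorem isCompactOperator_resolvent (K : C(Icc a b, L2 a b)) :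
    IsCompactOperator (resolvent K) := by
  rw [resolvent, ContinuousLinearMap.coe_comp]
  exact (isCompactOperator_innerOp K).clm_comp (ContinuousMap.toLp 2 (leb a b) ℂ)

/-- On continuous functions this is the symmetry of `D` with the real `μ` terms cancelled; density
does the rest. -/
theorem resolvent_isSymmetric (hα : (α₀, α₁) ≠ (0, 0)) (hβ : (β₀, β₁) ≠ (0, 0)) {μ : ℝ}
    {K : C(Icc a b, L2 a b)}
    (hK : ∀ f : C(Icc a b, ℂ), ∃ y : F hab α₀ α₁ β₀ β₁,
      y.1 = innerOp K (toL2 f) ∧ D hab q α₀ α₁ β₀ β₁ y = (μ : ℂ) • y.1 + f) :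
    (resolvent K).IsSymmetric := by
  intro f g
  change inner ℂ (resolvent K f) g = inner ℂ f (resolvent K g)
  refine toL2_denseRange.induction_on₂ (p := fun f g : L2 a b =>
    inner ℂ (resolvent K f) g = inner ℂ f (resolvent K g)) ?_ ?_ f g
  · exact isClosed_eq (by fun_prop) (by fun_prop)
  · intro f g
    obtain ⟨y, hy, hDy⟩ := hK f
    obtain ⟨z, hz, hDz⟩ := hK g
    rw [resolvent_apply, resolvent_apply, ← hy, ← hz]
    have h := inner_D_left hab q hα hβ y z
    rw [hDy, hDz, toL2_add, toL2_add, toL2_smul, toL2_smul, inner_add_left, inner_add_right,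
      inner_smul_left, inner_smul_right, Complex.conj_ofReal] at h
    exact (add_left_cancel h).symm

/-- The kernel was built as a right inverse of `D - μ`; it is a left inverse because `D - μ` is
injective on `F`. -/
theorem resolvent_D {μ : ℝ} (hμ : (μ : ℂ) ∉ eigenvalues hab q α₀ α₁ β₀ β₁)
    {K : C(Icc a b, L2 a b)}
    (hK : ∀ f : C(Icc a b, ℂ), ∃ y : F hab α₀ α₁ β₀ β₁,
      y.1 = innerOp K (toL2 f) ∧ D hab q α₀ α₁ β₀ β₁ y = (μ : ℂ) • y.1 + f)
    (y : F hab α₀ α₁ β₀ β₁) :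
    resolvent K (toL2 (D hab q α₀ α₁ β₀ β₁ y - (μ : ℂ) • y.1)) = toL2 y.1 := by
  obtain ⟨z, hz, hDz⟩ := hK (D hab q α₀ α₁ β₀ β₁ y - (μ : ℂ) • y.1)
  rw [resolvent_apply, ← hz]
  by_contra hne
  refine hμ ⟨z - y, (mem_E hab).2 ?_, fun h0 => hne (by rw [(sub_eq_zero (a := z) (b := y)).1 h0])⟩
  rw [D_sub, hDz, Submodule.coe_sub, smul_sub]
  abel

theorem resolvent_of_mem_E {μ : ℝ} (hμ : (μ : ℂ) ∉ eigenvalues hab q α₀ α₁ β₀ β₁)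
    {K : C(Icc a b, L2 a b)}
    (hK : ∀ f : C(Icc a b, ℂ), ∃ y : F hab α₀ α₁ β₀ β₁,
      y.1 = innerOp K (toL2 f) ∧ D hab q α₀ α₁ β₀ β₁ y = (μ : ℂ) • y.1 + f)
    {l : ℂ} (hl : l ≠ μ) {y : F hab α₀ α₁ β₀ β₁} (hy : y ∈ E hab q α₀ α₁ β₀ β₁ l) :
    resolvent K (toL2 y.1) = (l - μ)⁻¹ • toL2 y.1 := by
  have h := resolvent_D hab hμ hK y
  have hsub : l • y.1 - (μ : ℂ) • y.1 = (l - μ) • y.1 := by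
    ext x
    simp only [ContinuousMap.sub_apply, ContinuousMap.smul_apply, smul_eq_mul]
    ring
  rw [(mem_E hab).1 hy, hsub, toL2_smul, map_smul] at h
  rw [eq_inv_smul_iff₀ (sub_ne_zero.2 hl), h]

/-- The space `F` contains the smooth functions with compact support in `(a,b)`. -/
theorem exists_mem_F_of_contDiff (α₀ α₁ β₀ β₁ : ℝ) {g : ℝ → ℝ} (hg : ContDiff ℝ 2 g)
    (hs : tsupport g ⊆ Ioo a b) :
    ∃ y : F hab α₀ α₁ β₀ β₁, ∀ x : Icc a b, y.1 x = (g x : ℂ) := by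
  have hgc := hg.continuous
  let y : C(Icc a b, ℂ) := ⟨fun x => (g x : ℂ), by fun_prop⟩
  have hg1 : ContDiff ℝ 1 (deriv g) := ContDiff.deriv' hg
  have hg2 : Continuous (deriv (deriv g)) := hg1.continuous_deriv le_rfl
  obtain ⟨hC, h1, -⟩ := mem_C2_of_hasDerivWithinAt hab (y := y) (g₀ := fun x => (g x : ℂ))
    (g₁ := fun x => ((deriv g x : ℝ) : ℂ)) (g₂ := fun x => ((deriv (deriv g) x : ℝ) : ℂ))
    (fun x hx => ext_of_mem hab y hx)
    (fun x _ => ((hg.differentiable (by norm_num)) x).hasDerivAt.ofReal_comp.hasDerivWithinAt)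
    (fun x _ => ((hg1.differentiable (by norm_num)) x).hasDerivAt.ofReal_comp.hasDerivWithinAt)
    (by fun_prop)
  have key : ∀ x (hx : x ∈ Icc a b), x ∉ Ioo a b → y ⟨x, hx⟩ = 0 ∧ d1 hab y x = 0 := by
    intro x hx hx'
    have hn : x ∉ tsupport g := fun h => hx' (hs h)
    refine ⟨?_, ?_⟩
    · change (g x : ℂ) = 0
      rw [image_eq_zero_of_notMem_tsupport hn, Complex.ofReal_zero]
    · rw [h1 x hx, deriv_of_notMem_tsupport hn, Complex.ofReal_zero]
  refine ⟨⟨y, hC, ?_, ?_⟩, fun x => rfl⟩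
  · obtain ⟨e1, e2⟩ := key a (left_mem_Icc.2 hab.le) (by simp)
    rw [e1, e2]; simp
  · obtain ⟨e1, e2⟩ := key b (right_mem_Icc.2 hab.le) (by simp)
    rw [e1, e2]; simp

/-- The space `F` is dense in `L²[a,b]`. -/
theorem eq_zero_of_inner_F_eq_zero (α₀ α₁ β₀ β₁ : ℝ) {f : L2 a b}
    (h : ∀ y : F hab α₀ α₁ β₀ β₁, inner ℂ (toL2 y.1) f = 0) : f = 0 := by
  have hmeas := map_comap_subtype_coe (measurableSet_Icc (a := a) (b := b)) (volume : Measure ℝ)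
  have hfi : Integrable f (leb a b) := (Lp.memLp f).integrable (by norm_num)
  have hint : IntegrableOn (IccExtend hab.le f) (Icc a b) := by
    rw [IntegrableOn, ← hmeas,
      (MeasurableEmbedding.subtype_coe measurableSet_Icc).integrable_map_iff]
    refine hfi.congr (Eventually.of_forall fun x => ?_)
    exact (IccExtend_val _ _ _).symm
  -- Fundamental lemma of the calculus of variations on the open interval; the endpoints are null.
  have hae := isOpen_Ioo.ae_eq_zero_of_integral_contDiff_smul_eq_zero (U := Ioo a b)
    (f := IccExtend hab.le f) (μ := volume)
    (hint.mono_set Ioo_subset_Icc_self).locallyIntegrableOn (by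
      intro g hg _ hs
      obtain ⟨y, hy⟩ := exists_mem_F_of_contDiff hab α₀ α₁ β₀ β₁
        (mod_cast contDiff_infty.1 hg 2) hs
      rw [← setIntegral_eq_integral_of_forall_compl_eq_zero (s := Icc a b),
        ← integral_subtype_comap measurableSet_Icc, ← h y, L2.inner_def]
      · refine integral_congr_ae ?_
        filter_upwards [ContinuousMap.coeFn_toLp (p := 2) (𝕜 := ℂ) (leb a b) y.1] with x hx
        rw [toL2, hx, hy, IccExtend_val, RCLike.inner_apply, Complex.conj_ofReal,
          Complex.real_smul, mul_comm]
      · intro x hx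
        rw [image_eq_zero_of_notMem_tsupport fun h => hx (Ioo_subset_Icc_self (hs h)), zero_smul])
  have hae' : ∀ᵐ x ∂(volume.restrict (Icc a b)), IccExtend hab.le f x = 0 := by
    rw [← restrict_Ioo_eq_restrict_Icc, ae_restrict_iff' measurableSet_Ioo]
    exact hae
  rw [Lp.eq_zero_iff_ae_eq_zero]
  filter_upwards [(ae_leb_iff (p := fun x => IccExtend hab.le f x = 0)).2 hae'] with x hx
  simpa using hx

/-- By symmetry the kernel is orthogonal to the range, which contains the dense space `F`. -/
theorem resolvent_eq_zero (hα : (α₀, α₁) ≠ (0, 0)) (hβ : (β₀, β₁) ≠ (0, 0)) {μ : ℝ}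
    (hμ : (μ : ℂ) ∉ eigenvalues hab q α₀ α₁ β₀ β₁) {K : C(Icc a b, L2 a b)}
    (hK : ∀ f : C(Icc a b, ℂ), ∃ y : F hab α₀ α₁ β₀ β₁,
      y.1 = innerOp K (toL2 f) ∧ D hab q α₀ α₁ β₀ β₁ y = (μ : ℂ) • y.1 + f)
    {f : L2 a b} (hf : resolvent K f = 0) : f = 0 := by
  refine eq_zero_of_inner_F_eq_zero hab α₀ α₁ β₀ β₁ fun y => ?_
  have hs := resolvent_isSymmetric hab hα hβ hK
  rw [← resolvent_D hab hμ hK y]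
  refine (hs _ _).trans ?_
  change inner ℂ _ (resolvent K f) = 0
  rw [hf, inner_zero_right]

/-- Regularity by bootstrap: `f = ν⁻¹ • resolvent K f` has a continuous representative, and the
kernel maps continuous functions into `F`. -/
theorem exists_mem_E_of_resolvent_eq_smul {μ : ℝ} {K : C(Icc a b, L2 a b)}
    (hK : ∀ f : C(Icc a b, ℂ), ∃ y : F hab α₀ α₁ β₀ β₁,
      y.1 = innerOp K (toL2 f) ∧ D hab q α₀ α₁ β₀ β₁ y = (μ : ℂ) • y.1 + f)
    {f : L2 a b} {ν : ℂ} (hν : ν ≠ 0) (hf : resolvent K f = ν • f) :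
    ∃ y ∈ E hab q α₀ α₁ β₀ β₁ (μ + ν⁻¹), toL2 y.1 = f := by
  have hf' : toL2 (ν⁻¹ • innerOp K f) = f := by
    rw [toL2_smul, ← resolvent_apply, hf, inv_smul_smul₀ hν]
  obtain ⟨y, hy, hDy⟩ := hK (ν⁻¹ • innerOp K f)
  rw [hf'] at hy
  refine ⟨ν⁻¹ • y, Submodule.smul_mem _ _ ((mem_E hab).2 ?_), ?_⟩
  · rw [hDy, ← hy]
    ext x
    simp only [ContinuousMap.add_apply, ContinuousMap.smul_apply, smul_eq_mul]
    ring
  · rw [Submodule.coe_smul, hy, hf']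

/-- Eigenfunctions to all the eigenvalues span a dense subspace of `L²[a,b]`. -/
theorem orthogonal_span_eigenfunctions_eq_bot (hα : (α₀, α₁) ≠ (0, 0)) (hβ : (β₀, β₁) ≠ (0, 0))
    {ι : Type*} {l : ι → ℂ} (hl : eigenvalues hab q α₀ α₁ β₀ β₁ ⊆ range l)
    {e : ι → F hab α₀ α₁ β₀ β₁} (he : ∀ i, e i ∈ E hab q α₀ α₁ β₀ β₁ (l i))
    (hn : ∀ i, ‖toL2 (e i).1‖ = 1) :
    (Submodule.span ℂ (range fun i => toL2 (e i).1))ᗮ = ⊥ := by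
  obtain ⟨μ, hμ⟩ := exists_real_notMem_eigenvalues hab q hα hβ
  obtain ⟨K, hK⟩ := exists_resolvent_kernel hab q hα hμ
  rw [eq_bot_iff, ← ContinuousLinearMap.orthogonalComplement_iSup_eigenspaces_eq_bot
    (isCompactOperator_resolvent K) (resolvent_isSymmetric hab hα hβ hK)]
  -- By the spectral theorem it suffices that every eigenvector of the resolvent lies in the span.
  refine Submodule.orthogonal_le (iSup_le fun ν f hf => ?_)
  have hf' : resolvent K f = ν • f := Module.End.mem_eigenspace_iff.1 hf
  by_cases hν : ν = 0
  · rw [hν, zero_smul] at hf'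
    rw [resolvent_eq_zero hab hα hβ hμ hK hf']
    exact Submodule.zero_mem _
  obtain ⟨y, hy, rfl⟩ := exists_mem_E_of_resolvent_eq_smul hab hK hν hf'
  by_cases hy0 : y = 0
  · rw [hy0, show toL2 (0 : F hab α₀ α₁ β₀ β₁).1 = 0 from toL2_zero]
    exact Submodule.zero_mem _
  obtain ⟨i, hi⟩ := hl ⟨y, hy, hy0⟩
  have hei := he i
  rw [hi] at hei
  have hei0 : e i ≠ 0 := by
    intro h0
    have := hn i
    rw [h0, show toL2 (0 : F hab α₀ α₁ β₀ β₁).1 = 0 from toL2_zero, norm_zero] at this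
    exact zero_ne_one this
  obtain ⟨c, rfl⟩ := exists_smul_eq_of_mem_E hab hα hei hei0 hy
  rw [Submodule.coe_smul, toL2_smul]
  exact Submodule.smul_mem _ _ (Submodule.subset_span ⟨i, rfl⟩)

/-- Polynomials embed in `L²`, since one vanishing on an interval is zero. -/
theorem not_finiteDimensional_L2 (hab : a < b) : ¬ FiniteDimensional ℂ (L2 a b) := by
  intro hfin
  let p : Polynomial ℂ →ₗ[ℂ] L2 a b :=
    { toFun := fun p => toL2 ⟨fun x : Icc a b => p.eval ((x : ℝ) : ℂ), by fun_prop⟩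
      map_add' := fun p r => by
        rw [← toL2_add]
        congr 1
        ext x
        simp
      map_smul' := fun c p => by
        rw [RingHom.id_apply, ← toL2_smul]
        congr 1
        ext x
        simp }
  have hp : Function.Injective p := by
    intro r s hrs
    have h := toL2_injective hab hrs
    refine Polynomial.eq_of_infinite_eval_eq r s
      (((Icc_infinite hab).image Complex.ofReal_injective.injOn).mono ?_)
    rintro _ ⟨x, hx, rfl⟩
    exact DFunLike.congr_fun h ⟨x, hx⟩
  exact Polynomial.not_finite (Module.Finite.of_injective p hp)

theorem infinite_eigenvalues (q : C(Icc a b, ℝ)) (hα : (α₀, α₁) ≠ (0, 0))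
    (hβ : (β₀, β₁) ≠ (0, 0)) : (eigenvalues hab q α₀ α₁ β₀ β₁).Infinite := by
  intro hfin
  have : Finite (eigenvalues hab q α₀ α₁ β₀ β₁) := hfin
  choose e he hn using fun l : eigenvalues hab q α₀ α₁ β₀ β₁ =>
    exists_normalized_eigenfunction hab l.2
  have h := orthogonal_span_eigenfunctions_eq_bot hab hα hβ (l := Subtype.val)
    (by rw [Subtype.range_coe]) he hn
  have hf := FiniteDimensional.span_of_finite ℂ (finite_range fun i => toL2 (e i).1)
  rw [Submodule.orthogonal_eq_bot_iff] at h
  rw [h] at hf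
  exact not_finiteDimensional_L2 hab (Module.finite_def.2 (Module.Finite.iff_fg.1 hf))

theorem tendsto_abs_eigenvalues (hα : (α₀, α₁) ≠ (0, 0)) (hβ : (β₀, β₁) ≠ (0, 0)) {l : ℕ → ℝ}
    (hl : Function.Injective l) (hle : ∀ n, (l n : ℂ) ∈ eigenvalues hab q α₀ α₁ β₀ β₁) :
    Tendsto (fun n => |l n|) atTop atTop := by
  obtain ⟨μ, hμ⟩ := exists_real_notMem_eigenvalues hab q hα hβ
  obtain ⟨K, hK⟩ := exists_resolvent_kernel hab q hα hμ
  choose e he hn using fun n => exists_normalized_eigenfunction hab (hle n)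
  have hne : ∀ n, (l n : ℂ) ≠ μ := fun n h => hμ (h ▸ hle n)
  have ho := orthonormal_of_mem_E hab hα hβ (Complex.ofReal_injective.comp hl) he hn
  have h0 := (tendsto_eigenvalue_zero (isCompactOperator_resolvent K)
    (resolvent_isSymmetric hab hα hβ hK) ho
    (fun n => resolvent_of_mem_E hab hμ hK (hne n) (he n))).norm
  have h1 : Tendsto (fun n => ‖((l n : ℂ) - μ)⁻¹‖) atTop (𝓝[>] 0) := by
    refine tendsto_nhdsWithin_iff.2 ⟨by simpa using h0, Eventually.of_forall fun n => ?_⟩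
    exact norm_pos_iff.2 (inv_ne_zero (sub_ne_zero.2 (hne n)))
  -- Uses `|l n| ≥ |l n - μ| - |μ|`.
  have h2 := tendsto_atTop_add_const_right atTop (-|μ|) h1.inv_tendsto_nhdsGT_zero
  refine tendsto_atTop_mono (fun n => ?_) h2
  have : ‖(l n : ℂ) - μ‖ = |l n - μ| := by
    rw [← Complex.ofReal_sub, Complex.norm_real, Real.norm_eq_abs]
  simp only [Pi.inv_apply, norm_inv, inv_inv, this]
  have := abs_sub (l n) μ
  linarith

end Resolvent

end SturmLiouville

end
theorem mainTheorem10 {a b : ℝ} (hab : a < b) (q : C(Icc a b, ℝ)) (α₀ α₁ β₀ β₁ : ℝ)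
    (hα : (α₀, α₁) ≠ (0, 0)) (hβ : (β₀, β₁) ≠ (0, 0)) :
    ∃ l : ℕ → ℝ, Function.Injective l ∧
      SturmLiouville.eigenvalues hab q α₀ α₁ β₀ β₁ = range (fun n => (l n : ℂ)) ∧
      Tendsto (fun n => |l n|) atTop atTop ∧
      (Function.Injective (SturmLiouville.D hab q α₀ α₁ β₀ β₁) → ∀ n, l n ≠ 0) ∧
      (∀ n, Module.finrank ℂ (SturmLiouville.E hab q α₀ α₁ β₀ β₁ (l n)) = 1) ∧
      (∀ e : ℕ → SturmLiouville.F hab α₀ α₁ β₀ β₁,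
        (∀ n, e n ∈ SturmLiouville.E hab q α₀ α₁ β₀ β₁ (l n)) →
        (∀ n, ‖SturmLiouville.toL2 (e n).1‖ = 1) →
        ∃ B : HilbertBasis ℕ ℂ (SturmLiouville.L2 a b),
          ∀ n, B n = SturmLiouville.toL2 (e n).1) := by
  have : Countable (SturmLiouville.eigenvalues hab q α₀ α₁ β₀ β₁) :=
    SturmLiouville.countable_eigenvalues hab hα hβ
  have : Infinite (SturmLiouville.eigenvalues hab q α₀ α₁ β₀ β₁) :=
    (SturmLiouville.infinite_eigenvalues hab q hα hβ).to_subtype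
  -- Any enumeration will do, since the growth statement holds for every injective sequence of
  -- eigenvalues.
  obtain ⟨φ⟩ := nonempty_equiv_of_countable
    (α := ℕ) (β := SturmLiouville.eigenvalues hab q α₀ α₁ β₀ β₁)
  have hre : ∀ n, (((φ n).1.re : ℝ) : ℂ) = (φ n).1 := fun n =>
    Complex.conj_eq_iff_re.1 (SturmLiouville.conj_eigenvalue hab hα hβ (φ n).2)
  have hinj : Function.Injective fun n => (φ n).1.re := by
    intro m n h
    refine φ.injective (Subtype.ext ?_)
    rw [← hre m, ← hre n]
    exact congrArg _ h
  have hmem : ∀ n, (((φ n).1.re : ℝ) : ℂ) ∈ SturmLiouville.eigenvalues hab q α₀ α₁ β₀ β₁ :=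
    fun n => by rw [hre]; exact (φ n).2
  have hrange : SturmLiouville.eigenvalues hab q α₀ α₁ β₀ β₁ =
      range (fun n => (((φ n).1.re : ℝ) : ℂ)) := by
    refine Subset.antisymm (fun z hz => ⟨φ.symm ⟨z, hz⟩, ?_⟩) ?_
    · simp only [hre]
      rw [Equiv.apply_symm_apply]
    · rintro _ ⟨n, rfl⟩
      exact hmem n
  refine ⟨fun n => (φ n).1.re, hinj, hrange,
    SturmLiouville.tendsto_abs_eigenvalues hab hα hβ hinj hmem, fun hD n hn => ?_,
    fun n => SturmLiouville.finrank_E_eq_one hab hα (hmem n), fun e he hn => ?_⟩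
  · obtain ⟨y, hy, hy0⟩ := hmem n
    refine hy0 (hD ?_)
    have hn' : (φ n).1.re = 0 := hn
    rw [(SturmLiouville.mem_E hab).1 hy, hn', map_zero, Complex.ofReal_zero]
    ext x
    simp
  · refine ⟨HilbertBasis.mkOfOrthogonalEqBot (SturmLiouville.orthonormal_of_mem_E hab hα hβ
      (Complex.ofReal_injective.comp hinj) he hn)
      (SturmLiouville.orthogonal_span_eigenfunctions_eq_bot hab hα hβ hrange.subset he hn),
      fun n => ?_⟩
    rw [HilbertBasis.coe_mkOfOrthogonalEqBot]
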